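/- Let $F$ be a continuous distribution function on $\mathbb R$ and let $(\alpha_n)_{n\ge1}$ be a sequence of positive reals with $s_n:=\sum_{k=1}^n\alpha_k\to\infty$ as $n\to\infty$. Let $(\mathcal X_n)_{n\ge1}$ be an $F^\alpha$-scheme, i.e. a sequence of independent real random variables on a common probability space such that $\mathcal X_n$ has distribution function $F^{\alpha_n}$ for every $n\ge1$, and let $\mathcal M_n:=\max_{1\le k\le n}\mathcal X_k$ be its partial maxima. Let $(\ell_n)_{n\ge1}$ be a non-decreasing sequence of real numbers, and put $q_n:=1-F(\ell_n)$. Write $\{\mathcal M_n>\ell_n\ \text{ev.}\}$ for the event that $\mathcal M_n>\ell_n$ for all sufficiently large $n$. Then: (i) $\mathbb P(\mathcal M_n>\ell_n\ \text{ev.})$ is either $0$ or $1$. (ii) If $q_n\to c$ as $n\to\infty$ for some $c>0$, then $\mathbb P(\mathcal M_n>\ell_n\ \text{ev.})=1$. (iii) If $q_n\to0$ and $\liminf_{n\to\infty}s_nq_n<\infty$, then $\mathbb P(\mathcal M_n>\ell_n\ \text{ev.})=0$. (iv) If $q_n\to0$ and $s_nq_n\to\infty$, then $$\mathbb P(\mathcal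 M_n>\ell_n\ \text{ev.})=\begin{cases}0&\text{if }K(\ell)=\infty,\\ 1&\text{if }K(\ell)<\infty,\end{cases}\qquad\text{where } K(\ell):=\sum_{n\ge1}e^{-s_nq_n}\bigl(1-e^{-\alpha_{n+1}q_n}\bigr).$$ -/

import Mathlib

open MeasureTheory ProbabilityTheory Filter Topology
open scoped ENNReal

noncomputable section

/-- `X` is an `F^α`-scheme on `(Ω, μ)`: the `X n` are independent random variables and `X n` has
distribution function `F ^ (α n)`. Sequences are indexed from `0`. -/
structure IsFAlphaScheme {Ω : Type*} [MeasurableSpace Ω] (μ : Measure Ω)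
    (F : ℝ → ℝ) (α : ℕ → ℝ) (X : ℕ → Ω → ℝ) : Prop where
  measurable : ∀ n, Measurable (X n)
  indep : iIndepFun X μ
  cdf_eq : ∀ n x, μ {ω | X n ω ≤ x} = ENNReal.ofReal (F x ^ α n)

/-- The partial maximum of `X 0, …, X n`. -/
def partialMax {Ω : Type*} (X : ℕ → Ω → ℝ) (n : ℕ) (ω : Ω) : ℝ :=
  (Finset.range (n + 1)).sup' Finset.nonempty_range_add_one (fun k => X k ω)

/-- The partial sum `s n = α 0 + ⋯ + α n`. -/
def partialSum (α : ℕ → ℝ) (n : ℕ) : ℝ := ∑ k ∈ Finset.range (n + 1), α k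

/-- The tail `q n = 1 - F (ℓ n)`. -/
def tailAt (F : ℝ → ℝ) (ℓ : ℕ → ℝ) (n : ℕ) : ℝ := 1 - F (ℓ n)

/-- The series `K(ℓ)` of nonnegative terms, with value in `[0, ∞]`. -/
def seriesK (F : ℝ → ℝ) (α ℓ : ℕ → ℝ) : ℝ≥0∞ :=
  ∑' n : ℕ, ENNReal.ofReal
    (Real.exp (-(partialSum α n * tailAt F ℓ n)) *
      (1 - Real.exp (-(α (n + 1) * tailAt F ℓ n))))

/-- The event that the partial maxima eventually exceed `ℓ`. -/
def eventuallyAbove {Ω : Type*} (X : ℕ → Ω → ℝ) (ℓ : ℕ → ℝ) : Set Ω :=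
  {ω | ∀ᶠ n in atTop, ℓ n < partialMax X n ω}

end

/-!
The complement of `eventuallyAbove X ℓ` is the event that infinitely many of the events
`E n = {M n ≤ ℓ n}` occur. Put `r n = -log (F (ℓ n))`. For `i ≤ j` the probability of `E i ∩ E j` is
`exp (s i * r j - s i * r i - s j * r j)`, so the `E n` are correlated like the events that a unit
Poisson process has no point in the rectangle `[0, s n] × [0, r n]`.

If `q n → 0`, every single variable is eventually at most `ℓ n`, the event is a tail event up to a
null set, and Kolmogorov's law applies; recurrence of the `E n` then only needs a lower bound on the
probability of `⋃ n ≥ N, E n` that does not depend on `N`. If `s n * q n` is bounded along a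
subsequence, a single `E n` provides it.

Otherwise `P (E n \ E (n + 1))` is at most `exp (-(r n * s n)) - exp (-(r n * s (n + 1)))`, which
is the `n`-th term of `K(ℓ)` with `r n` in place of `q n`. If `K(ℓ)` converges, so does the sum of
these probabilities, and as `P (E n) → 0`, leaving the `E n` finitely often means being in finitely
many. If `K(ℓ)` diverges, the sum of the indicators of `E n` with weights
`1 - exp (-(r n * α (n + 1)))` has a diverging mean `A`. Pairs with `s i * r j ≤ 1` contribute
`O(A ^ 2)` to its second moment. For the other pairs, the sum over the index with the larger area
`s n * r n` is a Riemann sum of an exponential integral and hence bounded, so that they contribute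
`O(A)`. The second moment method concludes. Passing between `r n` and `q n` costs constant factors
and the telescoping series `∑ ((s n)⁻¹ - (s (n + 1))⁻¹)`.
-/

lemma exp_sub_exp_le_sub {Ψ ψ : ℝ → ℝ} {c r u v : ℝ} (huv : u ≤ v)
    (hΨ : ∀ t ∈ Set.Icc u v, HasDerivAt Ψ (ψ t) t)
    (h : ∀ t ∈ Set.Icc u v, r * Real.exp (c - r * t) ≤ ψ t) :
    Real.exp (c - r * u) - Real.exp (c - r * v) ≤ Ψ v - Ψ u := by
  have hd : ∀ t ∈ Set.Icc u v, HasDerivAt (fun t => Ψ t + Real.exp (c - r * t))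
      (ψ t + Real.exp (c - r * t) * (-(r * 1))) t := fun t ht =>
    (hΨ t ht).add (((hasDerivAt_id t).const_mul r).const_sub c).exp
  have hmono := monotoneOn_of_hasDerivWithinAt_nonneg (convex_Icc u v)
    (fun t ht => (hd t ht).continuousAt.continuousWithinAt)
    (fun t ht => (hd t (interior_subset ht)).hasDerivWithinAt)
    (fun t ht => by linarith [h t (interior_subset ht)])
  linarith [hmono (Set.left_mem_Icc.2 huv) (Set.right_mem_Icc.2 huv) huv]

lemma mul_exp_neg_mul_le_inv {c : ℝ} (hc : 0 < c) (x : ℝ) :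
    x * Real.exp (-(c * x)) ≤ c⁻¹ := by
  rw [Real.exp_neg, ← div_eq_mul_inv, div_le_iff₀ (Real.exp_pos _), inv_mul_eq_div,
    le_div_iff₀ hc]
  linarith [Real.add_one_le_exp (c * x)]

lemma hasDerivAt_exp_neg_mul (r t : ℝ) :
    HasDerivAt (fun t => Real.exp (-(r * t))) (-(r * Real.exp (-(r * t)))) t := by
  simpa [mul_comm] using ((hasDerivAt_id' t).const_mul r).fun_neg.exp

lemma exp_neg_sub_exp_neg_le_two_mul {q r u v : ℝ} (hu : 0 ≤ u) (huv : u ≤ v) (hqr : q ≤ r)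
    (hr : r ≤ 2 * q) :
    Real.exp (-(r * u)) - Real.exp (-(r * v)) ≤
      2 * (Real.exp (-(q * u)) - Real.exp (-(q * v))) := by
  have h := exp_sub_exp_le_sub (c := 0) (r := r) huv
    (fun t _ => (hasDerivAt_exp_neg_mul q t).const_mul (-2)) fun t ht => by
      have hq : 0 ≤ q := by linarith
      have ht0 : 0 ≤ t := hu.trans ht.1
      calc r * Real.exp (0 - r * t) ≤ (2 * q) * Real.exp (-(q * t)) := by
            rw [zero_sub]; gcongr
        _ = -2 * -(q * Real.exp (-(q * t))) := by ring
  simp only [zero_sub] at h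
  linarith

/- If `t * q ^ 2 ≤ 1`, the exponents differ by at most `2`; otherwise the left-hand side is already
integrable at infinity, because `exp (q * t) ≥ (q * t) ^ 4 / 24 ≥ t ^ 2 / 24`. -/
lemma mul_exp_neg_le_of_le_add_sq {q r t : ℝ} (ht : 0 < t) (hq : 0 ≤ q) (hq1 : q ≤ 1)
    (hqr : q ≤ r) (hr : r ≤ q + 2 * q ^ 2) :
    q * Real.exp (-(q * t)) ≤ Real.exp 2 * (r * Real.exp (-(r * t))) + 24 / t ^ 2 := by
  have hr0 : 0 ≤ r := hq.trans hqr
  rcases le_or_gt (t * q ^ 2) 1 with hsmall | hlarge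
  · have hexp : Real.exp (-(q * t)) ≤ Real.exp 2 * Real.exp (-(r * t)) := by
      rw [← Real.exp_add]
      gcongr
      nlinarith
    calc q * Real.exp (-(q * t)) ≤ r * (Real.exp 2 * Real.exp (-(r * t))) := by gcongr
      _ = Real.exp 2 * (r * Real.exp (-(r * t))) := by ring
      _ ≤ _ := le_add_of_nonneg_right (by positivity)
  · have hexp : t ^ 2 ≤ 24 * Real.exp (q * t) := by
      have hpow : (q * t) ^ 4 / 24 ≤ Real.exp (q * t) :=
        Real.pow_div_factorial_le_exp (q * t) (by positivity) 4
      calc t ^ 2 ≤ t ^ 2 * (t * q ^ 2) ^ 2 :=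
            le_mul_of_one_le_right (by positivity) (one_le_pow₀ hlarge.le)
        _ = (q * t) ^ 4 := by ring
        _ ≤ 24 * Real.exp (q * t) := by linarith
    calc q * Real.exp (-(q * t)) ≤ 1 * Real.exp (-(q * t)) := by gcongr
      _ ≤ 24 / t ^ 2 := by
        rw [one_mul, Real.exp_neg, ← one_div, div_le_div_iff₀ (Real.exp_pos _) (by positivity)]
        linarith
      _ ≤ _ := le_add_of_nonneg_left (by positivity)

lemma exp_neg_sub_exp_neg_le_add_inv {q r u v : ℝ} (hu : 0 < u) (huv : u ≤ v) (hq : 0 ≤ q)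
    (hq1 : q ≤ 1) (hqr : q ≤ r) (hr : r ≤ q + 2 * q ^ 2) :
    Real.exp (-(q * u)) - Real.exp (-(q * v)) ≤
      Real.exp 2 * (Real.exp (-(r * u)) - Real.exp (-(r * v))) + 24 * (u⁻¹ - v⁻¹) := by
  have h := exp_sub_exp_le_sub (c := 0) (r := q) huv
    (fun t ht => ((hasDerivAt_exp_neg_mul r t).const_mul (-Real.exp 2)).sub
      ((hasDerivAt_inv (hu.trans_le ht.1).ne').const_mul 24)) fun t ht => by
      rw [zero_sub]
      convert mul_exp_neg_le_of_le_add_sq (hu.trans_le ht.1) hq hq1 hqr hr using 1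
      ring
  simp only [zero_sub, Pi.sub_apply] at h
  linarith

lemma one_sub_le_neg_log {x : ℝ} (hx : 0 < x) : 1 - x ≤ -Real.log x := by
  linarith [Real.log_le_sub_one_of_pos hx]

lemma neg_log_le_add_sq {x : ℝ} (hx : 1 / 2 ≤ x) :
    -Real.log x ≤ (1 - x) + 2 * (1 - x) ^ 2 := by
  have hx0 : 0 < x := by linarith
  have hlog := Real.one_sub_inv_le_log_of_pos hx0
  have hinv : x⁻¹ - 1 ≤ (1 - x) + 2 * (1 - x) ^ 2 := by
    rw [sub_le_iff_le_add, inv_le_iff_one_le_mul₀ hx0]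
    nlinarith [mul_nonneg (sub_nonneg.2 hx) (sq_nonneg (1 - x))]
  linarith

/- For `t ≤ 2 * σ` the rates `r` and `ρ` are comparable; beyond `2 * σ` only `1 ≤ σ * r` is left,
which gives exponential decay at rate `1 / (4 * σ)`. -/
lemma mul_exp_sub_le_of_rate_le {σ ρ r t : ℝ} (hσ : 0 < σ) (hr : r ≤ ρ) (hσt : σ ≤ t)
    (hρ : σ * ρ ≤ t * r) (h1 : 1 ≤ σ * r) :
    r * Real.exp (σ * r - r * t) ≤
      ρ * Real.exp (-(ρ / 2 * (t - σ))) + 2 / σ * Real.exp (-((4 * σ)⁻¹ * (t - σ))) := by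
  have hr0 : 0 < r := pos_of_mul_pos_right (one_pos.trans_le h1) hσ.le
  have hρ0 : 0 < ρ := hr0.trans_le hr
  have ht : 0 < t := hσ.trans_le hσt
  rcases le_or_gt t (2 * σ) with hnear | hfar
  · have hhalf : ρ / 2 ≤ r := by
      refine le_of_mul_le_mul_left ?_ ht
      nlinarith
    calc r * Real.exp (σ * r - r * t) ≤ ρ * Real.exp (-(ρ / 2 * (t - σ))) := by
          gcongr
          nlinarith [mul_nonneg (sub_nonneg.2 hhalf) (sub_nonneg.2 hσt)]
      _ ≤ _ := le_add_of_nonneg_right (by positivity)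
  · have hsplit : σ * r - r * t ≤ -(t / 4 * r) + -(t / 4 * r) := by nlinarith
    have hrate : (4 * σ)⁻¹ * (t - σ) ≤ t / 4 * r := by
      rw [inv_mul_le_iff₀ (by positivity)]
      nlinarith
    have hcoef : r * Real.exp (-(t / 4 * r)) ≤ 2 / σ := by
      calc r * Real.exp (-(t / 4 * r)) ≤ (t / 4)⁻¹ := mul_exp_neg_mul_le_inv (by positivity) r
        _ ≤ (σ / 2)⁻¹ := inv_anti₀ (by positivity) (by linarith)
        _ = 2 / σ := inv_div σ 2
    calc r * Real.exp (σ * r - r * t)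
        ≤ r * (Real.exp (-(t / 4 * r)) * Real.exp (-(t / 4 * r))) := by
          rw [← Real.exp_add]; gcongr
      _ = r * Real.exp (-(t / 4 * r)) * Real.exp (-(t / 4 * r)) := by ring
      _ ≤ 2 / σ * Real.exp (-((4 * σ)⁻¹ * (t - σ))) := by gcongr
      _ ≤ _ := le_add_of_nonneg_left (by positivity)

lemma mul_exp_sub_le_of_le_rate {σ ρ r t : ℝ} (hr : ρ ≤ r) (ht : 0 < t) (htσ : t ≤ σ)
    (hρ : σ * ρ ≤ t * r) (h1 : 1 ≤ t * ρ) :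
    r * Real.exp (t * ρ - r * t) ≤ 8 / σ + ρ * Real.exp (-(ρ * (σ - t))) := by
  have hρ0 : 0 < ρ := pos_of_mul_pos_right (one_pos.trans_le h1) ht.le
  have hr0 : 0 < r := hρ0.trans_le hr
  have hσ : 0 < σ := ht.trans_le htσ
  rcases le_or_gt (σ / 8) t with hnear | hfar
  · have hexcess : (r - ρ) * Real.exp (-(t * (r - ρ))) ≤ 8 / σ :=
      calc (r - ρ) * Real.exp (-(t * (r - ρ))) ≤ t⁻¹ := mul_exp_neg_mul_le_inv ht _
        _ ≤ (σ / 8)⁻¹ := by gcongr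
        _ = 8 / σ := inv_div σ 8
    have hbase : ρ * Real.exp (-(t * (r - ρ))) ≤ ρ * Real.exp (-(ρ * (σ - t))) :=
      mul_le_mul_of_nonneg_left (Real.exp_le_exp.2 (by linarith)) hρ0.le
    calc r * Real.exp (t * ρ - r * t)
        = (r - ρ) * Real.exp (-(t * (r - ρ))) + ρ * Real.exp (-(t * (r - ρ))) := by
          rw [← add_mul]; ring_nf
      _ ≤ _ := add_le_add hexcess hbase
  · have hexp : (t * r) ^ 2 / 8 ≤ Real.exp (t * r / 2) := by
      have h := Real.pow_div_factorial_le_exp (t * r / 2) (by positivity) 2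
      norm_num at h
      linarith
    have hσtr : σ ≤ t * (t * r) := by nlinarith
    calc r * Real.exp (t * ρ - r * t) ≤ r * Real.exp (-(t * r / 2)) := by
          gcongr
          nlinarith
      _ ≤ 8 / σ := by
          rw [Real.exp_neg, ← div_eq_mul_inv, div_le_div_iff₀ (Real.exp_pos _) hσ]
          nlinarith
      _ ≤ _ := le_add_of_nonneg_right (by positivity)

/-- The probability that a unit Poisson process has no point in `[0, s n] × [0, r n]` but has one
in the strip `[s n, s (n + 1)] × [0, r n]`. With `r n = -log (F (ℓ n))` it is the probability of
`M n ≤ ℓ n < M (n + 1)`; with `r n = q n` it is the `n`-th term of `K(ℓ)`. -/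
noncomputable def escapeProb (s r : ℕ → ℝ) (n : ℕ) : ℝ :=
  Real.exp (-(r n * s n)) - Real.exp (-(r n * s (n + 1)))

/-- The conditional probability of a point in the strip `[s n, s (n + 1)] × [0, r n]`; these are
the weights of the second moment argument. -/
noncomputable def escapeWeight (s r : ℕ → ℝ) (n : ℕ) : ℝ :=
  1 - Real.exp (-(r n * (s (n + 1) - s n)))

/-- The contribution of a later index `j` to the pair correlation with `i`, per unit of
`escapeProb s r i`, when the two rectangles are strongly correlated (`1 ≤ s i * r j`) and the
area at `j` is at least the area at `i`. -/
noncomputable def forwardCharge (s r : ℕ → ℝ) (i j : ℕ) : ℝ :=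
  if 1 ≤ s i * r j ∧ s i * r i ≤ s j * r j then
    escapeWeight s r j * Real.exp (s i * r j - r j * s j) else 0

/-- The contribution of an earlier index `i` to the pair correlation with `j`, per unit of
`escapeProb s r j`, when the two rectangles are strongly correlated (`1 ≤ s i * r j`) and the
area at `i` is larger than the area at `j`. -/
noncomputable def backwardCharge (s r : ℕ → ℝ) (i j : ℕ) : ℝ :=
  if 1 ≤ s i * r j ∧ s j * r j < s i * r i then
    escapeWeight s r i * Real.exp (s i * r j - r i * s i) else 0

/-- A primitive of the bound of `mul_exp_sub_le_of_rate_le`. -/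
noncomputable def forwardPrimitive (σ ρ t : ℝ) : ℝ :=
  -(2 * Real.exp (-(ρ / 2 * (t - σ))) + 8 * Real.exp (-((4 * σ)⁻¹ * (t - σ))))

/-- A primitive of the bound of `mul_exp_sub_le_of_le_rate`. -/
noncomputable def backwardPrimitive (σ ρ t : ℝ) : ℝ := 8 / σ * t + Real.exp (-(ρ * (σ - t)))

lemma hasDerivAt_forwardPrimitive {σ : ℝ} (hσ : σ ≠ 0) (ρ t : ℝ) :
    HasDerivAt (forwardPrimitive σ ρ)
      (ρ * Real.exp (-(ρ / 2 * (t - σ))) + 2 / σ * Real.exp (-((4 * σ)⁻¹ * (t - σ)))) t := by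
  have h := ((((hasDerivAt_exp_neg_mul (ρ / 2) (t - σ)).comp_sub_const t σ).const_mul 2).fun_add
    (((hasDerivAt_exp_neg_mul (4 * σ)⁻¹ (t - σ)).comp_sub_const t σ).const_mul 8)).fun_neg
  refine h.congr_deriv ?_
  field_simp
  ring

lemma hasDerivAt_backwardPrimitive (σ ρ t : ℝ) :
    HasDerivAt (backwardPrimitive σ ρ) (8 / σ + ρ * Real.exp (-(ρ * (σ - t)))) t := by
  have h := ((hasDerivAt_id' t).const_mul (8 / σ)).fun_add
    ((hasDerivAt_exp_neg_mul ρ (σ - t)).comp_const_sub σ t)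
  exact h.congr_deriv (by ring)

lemma monotone_forwardPrimitive {σ ρ : ℝ} (hσ : 0 ≤ σ) (hρ : 0 ≤ ρ) :
    Monotone (forwardPrimitive σ ρ) := fun t u htu => by
  unfold forwardPrimitive
  gcongr

lemma monotone_backwardPrimitive {σ ρ : ℝ} (hσ : 0 ≤ σ) (hρ : 0 ≤ ρ) :
    Monotone (backwardPrimitive σ ρ) := fun t u htu => by
  unfold backwardPrimitive
  gcongr

section SecondMoment

variable {s r : ℕ → ℝ}

lemma escapeWeight_mul_exp (s r : ℕ → ℝ) (c : ℝ) (n : ℕ) :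
    escapeWeight s r n * Real.exp (c - r n * s n) =
      Real.exp (c - r n * s n) - Real.exp (c - r n * s (n + 1)) := by
  rw [escapeWeight, sub_mul, one_mul, ← Real.exp_add]
  ring_nf

lemma escapeWeight_mul_exp_neg (s r : ℕ → ℝ) (n : ℕ) :
    escapeWeight s r n * Real.exp (-(r n * s n)) = escapeProb s r n := by
  simpa only [zero_sub, escapeProb] using escapeWeight_mul_exp s r 0 n

lemma escapeWeight_nonneg (hs : Monotone s) (hr0 : ∀ n, 0 ≤ r n) (n : ℕ) :
    0 ≤ escapeWeight s r n := by
  rw [escapeWeight, sub_nonneg, Real.exp_le_one_iff, neg_nonpos]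
  exact mul_nonneg (hr0 n) (sub_nonneg.2 (hs n.le_succ))

lemma escapeProb_nonneg (hs : Monotone s) (hr0 : ∀ n, 0 ≤ r n) (n : ℕ) :
    0 ≤ escapeProb s r n := by
  rw [← escapeWeight_mul_exp_neg]
  exact mul_nonneg (escapeWeight_nonneg hs hr0 n) (Real.exp_pos _).le

lemma forwardCharge_nonneg (hs : Monotone s) (hr0 : ∀ n, 0 ≤ r n) (i j : ℕ) :
    0 ≤ forwardCharge s r i j := by
  unfold forwardCharge
  split_ifs
  · exact mul_nonneg (escapeWeight_nonneg hs hr0 j) (Real.exp_pos _).le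
  · exact le_rfl

lemma backwardCharge_nonneg (hs : Monotone s) (hr0 : ∀ n, 0 ≤ r n) (i j : ℕ) :
    0 ≤ backwardCharge s r i j := by
  unfold backwardCharge
  split_ifs
  · exact mul_nonneg (escapeWeight_nonneg hs hr0 i) (Real.exp_pos _).le
  · exact le_rfl

lemma forwardCharge_le_sub (hs : Monotone s) (hs0 : ∀ n, 0 < s n) (hr : Antitone r)
    (hr0 : ∀ n, 0 ≤ r n) {i j : ℕ} (hij : i ≤ j) :
    forwardCharge s r i j ≤
      forwardPrimitive (s i) (r i) (s (j + 1)) - forwardPrimitive (s i) (r i) (s j) := by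
  have hsj : s j ≤ s (j + 1) := hs j.le_succ
  unfold forwardCharge
  split_ifs with h
  · rw [escapeWeight_mul_exp]
    refine exp_sub_exp_le_sub hsj (fun t _ => hasDerivAt_forwardPrimitive (hs0 i).ne' (r i) t)
      fun t ht => mul_exp_sub_le_of_rate_le (hs0 i) (hr hij) ((hs hij).trans ht.1) ?_ h.1
    exact h.2.trans (mul_le_mul_of_nonneg_right ht.1 (hr0 j))
  · exact sub_nonneg.2 (monotone_forwardPrimitive (hs0 i).le (hr0 i) hsj)

lemma sum_forwardCharge_le (hs : Monotone s) (hs0 : ∀ n, 0 < s n) (hr : Antitone r)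
    (hr0 : ∀ n, 0 ≤ r n) {i m : ℕ} (him : i ≤ m) :
    ∑ j ∈ Finset.Ico i m, forwardCharge s r i j ≤ 10 := by
  have hstart : forwardPrimitive (s i) (r i) (s i) = -10 := by norm_num [forwardPrimitive]
  have hend : forwardPrimitive (s i) (r i) (s m) ≤ 0 := neg_nonpos.2 (by positivity)
  calc ∑ j ∈ Finset.Ico i m, forwardCharge s r i j
      ≤ ∑ j ∈ Finset.Ico i m,
          (forwardPrimitive (s i) (r i) (s (j + 1)) - forwardPrimitive (s i) (r i) (s j)) :=
        Finset.sum_le_sum fun j hj =>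
          forwardCharge_le_sub hs hs0 hr hr0 (Finset.mem_Ico.1 hj).1
    _ = forwardPrimitive (s i) (r i) (s m) - forwardPrimitive (s i) (r i) (s i) :=
        Finset.sum_Ico_sub (fun j => forwardPrimitive (s i) (r i) (s j)) him
    _ ≤ 10 := by linarith

lemma backwardCharge_le_sub (hs : Monotone s) (hs0 : ∀ n, 0 < s n) (hr : Antitone r)
    (hr0 : ∀ n, 0 ≤ r n) {i j : ℕ} (hij : i < j) :
    backwardCharge s r i j ≤
      backwardPrimitive (s j) (r j) (s (i + 1)) - backwardPrimitive (s j) (r j) (s i) := by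
  have hsi : s i ≤ s (i + 1) := hs i.le_succ
  unfold backwardCharge
  split_ifs with h
  · rw [escapeWeight_mul_exp]
    refine exp_sub_exp_le_sub hsi (fun t _ => hasDerivAt_backwardPrimitive (s j) (r j) t)
      fun t ht => ?_
    have hcov : s i * r j ≤ t * r j := mul_le_mul_of_nonneg_right ht.1 (hr0 j)
    have harea : s j * r j ≤ t * r i :=
      h.2.le.trans (mul_le_mul_of_nonneg_right ht.1 (hr0 i))
    calc r i * Real.exp (s i * r j - r i * t) ≤ r i * Real.exp (t * r j - r i * t) := by
          gcongr
          exact hr0 i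
      _ ≤ _ := mul_exp_sub_le_of_le_rate (hr hij.le) ((hs0 i).trans_le ht.1) (ht.2.trans (hs hij))
          harea (h.1.trans hcov)
  · exact sub_nonneg.2 (monotone_backwardPrimitive (hs0 j).le (hr0 j) hsi)

lemma sum_backwardCharge_le (hs : Monotone s) (hs0 : ∀ n, 0 < s n) (hr : Antitone r)
    (hr0 : ∀ n, 0 ≤ r n) (j : ℕ) :
    ∑ i ∈ Finset.range (j + 1), backwardCharge s r i j ≤ 9 := by
  have hdiag : backwardCharge s r j j = 0 := if_neg fun h => h.2.false
  have hstart : 0 ≤ backwardPrimitive (s j) (r j) (s 0) := by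
    have := hs0 0
    have := hs0 j
    unfold backwardPrimitive
    positivity
  have hend : backwardPrimitive (s j) (r j) (s j) = 9 := by
    rw [backwardPrimitive, div_mul_cancel₀ _ (hs0 j).ne']
    norm_num
  rw [Finset.sum_range_succ, hdiag, add_zero]
  calc ∑ i ∈ Finset.range j, backwardCharge s r i j
      ≤ ∑ i ∈ Finset.range j,
          (backwardPrimitive (s j) (r j) (s (i + 1)) - backwardPrimitive (s j) (r j) (s i)) :=
        Finset.sum_le_sum fun i hi =>
          backwardCharge_le_sub hs hs0 hr hr0 (Finset.mem_range.1 hi)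
    _ = backwardPrimitive (s j) (r j) (s j) - backwardPrimitive (s j) (r j) (s 0) :=
        Finset.sum_range_sub (fun i => backwardPrimitive (s j) (r j) (s i)) j
    _ ≤ 9 := by linarith

lemma escapeWeight_mul_escapeWeight_mul_exp_le (hs : Monotone s) (hr0 : ∀ n, 0 ≤ r n) (i j : ℕ) :
    escapeWeight s r i * escapeWeight s r j * Real.exp (s i * r j - r i * s i - r j * s j) ≤
      3 * (escapeProb s r i * escapeProb s r j) + escapeProb s r i * forwardCharge s r i j +
        escapeProb s r j * backwardCharge s r i j := by
  have ha := escapeProb_nonneg hs hr0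
  have hf := mul_nonneg (ha i) (forwardCharge_nonneg hs hr0 i j)
  have hb := mul_nonneg (ha j) (backwardCharge_nonneg hs hr0 i j)
  have haa := mul_nonneg (ha i) (ha j)
  rcases le_or_gt (s i * r j) 1 with hweak | hstrong
  · have hexp : Real.exp (s i * r j) ≤ 3 :=
      (Real.exp_le_exp.2 hweak).trans Real.exp_one_lt_three.le
    calc _ = Real.exp (s i * r j) * (escapeProb s r i * escapeProb s r j) := by
          rw [← escapeWeight_mul_exp_neg, ← escapeWeight_mul_exp_neg, sub_sub, Real.exp_sub,
            Real.exp_add, Real.exp_neg, Real.exp_neg]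
          field_simp
      _ ≤ 3 * (escapeProb s r i * escapeProb s r j) := by gcongr
      _ ≤ _ := by linarith
  · rcases le_or_gt (s i * r i) (s j * r j) with harea | harea
    · calc _ = escapeProb s r i * forwardCharge s r i j := by
            rw [forwardCharge, if_pos ⟨hstrong.le, harea⟩, ← escapeWeight_mul_exp_neg,
              mul_mul_mul_comm, ← Real.exp_add]
            ring_nf
        _ ≤ _ := by linarith
    · calc _ = escapeProb s r j * backwardCharge s r i j := by
            rw [backwardCharge, if_pos ⟨hstrong.le, harea⟩, ← escapeWeight_mul_exp_neg,
              mul_mul_mul_comm, ← Real.exp_add]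
            ring_nf
        _ ≤ _ := by linarith

lemma sum_triangle_escapeWeight_le (hs : Monotone s) (hs0 : ∀ n, 0 < s n) (hr : Antitone r)
    (hr0 : ∀ n, 0 ≤ r n) (m : ℕ) :
    ∑ j ∈ Finset.range m, ∑ i ∈ Finset.range (j + 1),
        escapeWeight s r i * escapeWeight s r j * Real.exp (s i * r j - r i * s i - r j * s j) ≤
      3 * (∑ n ∈ Finset.range m, escapeProb s r n) ^ 2 +
        19 * ∑ n ∈ Finset.range m, escapeProb s r n := by
  have ha := escapeProb_nonneg hs hr0
  set a := escapeProb s r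
  have hweak : ∑ j ∈ Finset.range m, ∑ i ∈ Finset.range (j + 1), a i * a j ≤
      (∑ n ∈ Finset.range m, a n) ^ 2 := by
    rw [sq, Finset.sum_mul_sum, Finset.sum_comm]
    exact Finset.sum_le_sum fun j hj => Finset.sum_le_sum_of_subset_of_nonneg
      (Finset.range_subset_range.2 (Finset.mem_range.1 hj)) fun i _ _ => mul_nonneg (ha i) (ha j)
  have hforward : ∑ j ∈ Finset.range m, ∑ i ∈ Finset.range (j + 1), a i * forwardCharge s r i j ≤
      10 * ∑ n ∈ Finset.range m, a n := by
    simp only [Finset.range_eq_Ico]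
    rw [← Finset.sum_Ico_Ico_comm, Finset.mul_sum]
    refine Finset.sum_le_sum fun i hi => ?_
    rw [← Finset.mul_sum, mul_comm]
    exact mul_le_mul_of_nonneg_right
      (sum_forwardCharge_le hs hs0 hr hr0 (Finset.mem_Ico.1 hi).2.le) (ha i)
  have hbackward : ∑ j ∈ Finset.range m, ∑ i ∈ Finset.range (j + 1),
      a j * backwardCharge s r i j ≤ 9 * ∑ n ∈ Finset.range m, a n := by
    rw [Finset.mul_sum]
    refine Finset.sum_le_sum fun j _ => ?_
    rw [← Finset.mul_sum, mul_comm]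
    exact mul_le_mul_of_nonneg_right (sum_backwardCharge_le hs hs0 hr hr0 j) (ha j)
  calc _ ≤ ∑ j ∈ Finset.range m, ∑ i ∈ Finset.range (j + 1),
        (3 * (a i * a j) + a i * forwardCharge s r i j + a j * backwardCharge s r i j) :=
      Finset.sum_le_sum fun j _ => Finset.sum_le_sum fun i _ =>
        escapeWeight_mul_escapeWeight_mul_exp_le hs hr0 i j
    _ ≤ _ := by
      simp only [Finset.sum_add_distrib, ← Finset.mul_sum]
      simp only [← Finset.mul_sum] at hforward hbackward hweak
      linarith

end SecondMoment

lemma sum_range_sum_range_le_two_mul_triangle {G : ℕ → ℕ → ℝ} (hG : ∀ i j, G i j = G j i)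
    (hdiag : ∀ i, 0 ≤ G i i) (m : ℕ) :
    ∑ i ∈ Finset.range m, ∑ j ∈ Finset.range m, G i j ≤
      2 * ∑ j ∈ Finset.range m, ∑ i ∈ Finset.range (j + 1), G i j := by
  induction m with
  | zero => simp
  | succ m ih =>
    simp only [Finset.sum_range_succ _ m, Finset.sum_add_distrib, fun i => hG m i] at ih ⊢
    linarith [hdiag m]

section Probability

variable {Ω : Type*} [MeasurableSpace Ω] {μ : Measure Ω}

lemma sq_integral_le_measureReal_mul_integral_sq [IsFiniteMeasure μ] {f : Ω → ℝ} {U : Set Ω}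
    (hf : MemLp f 2 μ) (hU : MeasurableSet U) (hfU : ∀ ω ∉ U, f ω = 0) :
    (∫ ω, f ω ∂μ) ^ 2 ≤ μ.real U * ∫ ω, f ω ^ 2 ∂μ := by
  have hf1 : Integrable f μ := hf.integrable one_le_two
  have hquad : ∀ c : ℝ,
      0 ≤ μ.real U * (c * c) + (-2 * ∫ ω, f ω ∂μ) * c + ∫ ω, f ω ^ 2 ∂μ := fun c => by
    have hind : Integrable (U.indicator fun _ => c * c) μ := (integrable_const _).indicator hU
    have hexpand : ∀ ω, (f ω - U.indicator (fun _ => c) ω) ^ 2 =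
        U.indicator (fun _ => c * c) ω + (-2 * c) * f ω + f ω ^ 2 := fun ω => by
      by_cases hω : ω ∈ U
      · simp only [Set.indicator_of_mem hω]; ring
      · simp only [Set.indicator_of_notMem hω, hfU ω hω]; ring
    calc 0 ≤ ∫ ω, (f ω - U.indicator (fun _ => c) ω) ^ 2 ∂μ :=
          integral_nonneg fun ω => sq_nonneg _
      _ = _ := by
          simp only [hexpand]
          rw [integral_add (hind.fun_add (hf1.const_mul _)) hf.integrable_sq,
            integral_add hind (hf1.const_mul _), integral_indicator_const _ hU,
            integral_const_mul, smul_eq_mul]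
          ring
  have hdiscrim := discrim_le_zero hquad
  rw [discrim] at hdiscrim
  linarith

/-- The weighted Chung–Erdős inequality. -/
lemma sq_sum_mul_measureReal_le [IsFiniteMeasure μ] {ι : Type*} (S : Finset ι) (w : ι → ℝ)
    {E : ι → Set Ω} (hE : ∀ i, MeasurableSet (E i)) :
    (∑ i ∈ S, w i * μ.real (E i)) ^ 2 ≤
      μ.real (⋃ i ∈ S, E i) * ∑ i ∈ S, ∑ j ∈ S, w i * w j * μ.real (E i ∩ E j) := by
  set f : Ω → ℝ := fun ω => ∑ i ∈ S, w i * (E i).indicator 1 ω with hf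
  have hint : ∀ {A : Set Ω}, MeasurableSet A → ∀ c : ℝ,
      Integrable (fun ω => c * A.indicator 1 ω) μ := fun hA c =>
    ((integrable_const (1 : ℝ)).indicator hA).const_mul c
  have hmem : MemLp f 2 μ := memLp_finsetSum _ fun i _ =>
    ((memLp_const (1 : ℝ)).indicator (hE i)).const_mul (w i)
  have hmean : ∫ ω, f ω ∂μ = ∑ i ∈ S, w i * μ.real (E i) := by
    simp only [hf]
    rw [integral_finsetSum _ fun i _ => hint (hE i) _]
    simp only [integral_const_mul, integral_indicator_one (hE _)]
  have hsq : ∀ ω, f ω ^ 2 = ∑ i ∈ S, ∑ j ∈ S, w i * w j * (E i ∩ E j).indicator 1 ω := fun ω => by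
    simp only [hf, sq, Finset.sum_mul_sum, Set.inter_indicator_one, Pi.mul_apply,
      mul_mul_mul_comm]
  have hsecond : ∫ ω, f ω ^ 2 ∂μ = ∑ i ∈ S, ∑ j ∈ S, w i * w j * μ.real (E i ∩ E j) := by
    simp only [hsq]
    rw [integral_finsetSum _ fun i _ =>
      integrable_finsetSum _ fun j _ => hint ((hE i).inter (hE j)) _]
    refine Finset.sum_congr rfl fun i _ => ?_
    rw [integral_finsetSum _ fun j _ => hint ((hE i).inter (hE j)) _]
    simp only [integral_const_mul, integral_indicator_one ((hE i).inter (hE _))]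
  rw [← hmean, ← hsecond]
  refine sq_integral_le_measureReal_mul_integral_sq hmem
    (S.measurableSet_biUnion fun i _ => hE i) fun ω hω => Finset.sum_eq_zero fun i hi => ?_
  rw [Set.indicator_of_notMem fun h => hω (Set.mem_biUnion hi h), mul_zero]

lemma sum_escapeWeight_mul_measureReal_inter_le {s r : ℕ → ℝ}
    (hs : Monotone s) (hs0 : ∀ n, 0 < s n) (hr : Antitone r) (hr0 : ∀ n, 0 ≤ r n)
    {E : ℕ → Set Ω} (hinter : ∀ i j, i ≤ j →
      μ.real (E i ∩ E j) = Real.exp (s i * r j - r i * s i - r j * s j)) (m : ℕ) :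
    ∑ i ∈ Finset.range m, ∑ j ∈ Finset.range m,
        escapeWeight s r i * escapeWeight s r j * μ.real (E i ∩ E j) ≤
      2 * (3 * (∑ n ∈ Finset.range m, escapeProb s r n) ^ 2 +
        19 * ∑ n ∈ Finset.range m, escapeProb s r n) := by
  have hw := escapeWeight_nonneg hs hr0
  calc _ ≤ 2 * ∑ j ∈ Finset.range m, ∑ i ∈ Finset.range (j + 1),
          escapeWeight s r i * escapeWeight s r j * μ.real (E i ∩ E j) :=
        sum_range_sum_range_le_two_mul_triangle
          (fun i j => by rw [mul_comm (escapeWeight s r i), Set.inter_comm])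
          (fun i => mul_nonneg (mul_nonneg (hw i) (hw i)) measureReal_nonneg) m
    _ = 2 * ∑ j ∈ Finset.range m, ∑ i ∈ Finset.range (j + 1), escapeWeight s r i *
          escapeWeight s r j * Real.exp (s i * r j - r i * s i - r j * s j) := by
        congr 1
        refine Finset.sum_congr rfl fun j _ => Finset.sum_congr rfl fun i hi => ?_
        rw [hinter i j (Finset.mem_range_succ_iff.1 hi)]
    _ ≤ _ := by
        gcongr
        exact sum_triangle_escapeWeight_le hs hs0 hr hr0 m

lemma le_measureReal_iUnion_of_not_summable_escapeProb [IsFiniteMeasure μ] {s r : ℕ → ℝ}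
    (hs : Monotone s) (hs0 : ∀ n, 0 < s n) (hr : Antitone r) (hr0 : ∀ n, 0 ≤ r n)
    {E : ℕ → Set Ω} (hE : ∀ n, MeasurableSet (E n))
    (hinter : ∀ i j, i ≤ j →
      μ.real (E i ∩ E j) = Real.exp (s i * r j - r i * s i - r j * s j))
    (hsum : ¬ Summable (escapeProb s r)) :
    1 / 44 ≤ μ.real (⋃ n, E n) := by
  have hdiverge := (not_summable_iff_tendsto_nat_atTop_of_nonneg (escapeProb_nonneg hs hr0)).1 hsum
  obtain ⟨m, hm⟩ := (hdiverge.eventually_ge_atTop 1).exists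
  set A := ∑ n ∈ Finset.range m, escapeProb s r n
  set B := μ.real (⋃ n ∈ Finset.range m, E n)
  have hmass : ∑ n ∈ Finset.range m, escapeWeight s r n * μ.real (E n) = A :=
    Finset.sum_congr rfl fun n _ => by
      have hEn := hinter n n le_rfl
      rw [Set.inter_self, mul_comm (s n), sub_self, zero_sub] at hEn
      rw [hEn, escapeWeight_mul_exp_neg]
  have hsecond : ∑ i ∈ Finset.range m, ∑ j ∈ Finset.range m,
      escapeWeight s r i * escapeWeight s r j * μ.real (E i ∩ E j) ≤ 44 * A ^ 2 :=
    (sum_escapeWeight_mul_measureReal_inter_le hs hs0 hr hr0 hinter m).trans (by nlinarith)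
  have hchung : A ^ 2 ≤ B * (44 * A ^ 2) := by
    rw [← hmass]
    refine (sq_sum_mul_measureReal_le _ _ hE).trans ?_
    rw [hmass]
    exact mul_le_mul_of_nonneg_left hsecond measureReal_nonneg
  have hA : 0 < A ^ 2 := pow_pos (one_pos.trans_le hm) 2
  calc 1 / 44 ≤ B := le_of_mul_le_mul_right (by linarith) hA
    _ ≤ μ.real (⋃ n, E n) := measureReal_mono (Set.iUnion₂_subset_iUnion _ _)

lemma le_measure_limsup [IsFiniteMeasure μ] {E : ℕ → Set Ω} (hE : ∀ n, MeasurableSet (E n))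
    {δ : ℝ≥0∞} (h : ∀ᶠ N in atTop, δ ≤ μ (⋃ n, E (n + N))) : δ ≤ μ (limsup E atTop) := by
  have hanti : Antitone fun N => ⋃ n, E (n + N) := fun M N hMN =>
    Set.iUnion_subset fun n => Set.subset_iUnion_of_subset (n + (N - M)) (by
      rw [add_assoc, Nat.sub_add_cancel hMN])
  rw [limsup_eq_iInf_iSup_of_nat']
  exact ge_of_tendsto (tendsto_measure_iInter_atTop
    (fun N => (MeasurableSet.iUnion fun n => hE (n + N)).nullMeasurableSet) hanti
    ⟨0, measure_ne_top _ _⟩) h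

/-- The Barndorff-Nielsen strengthening of the first Borel–Cantelli lemma. -/
lemma measure_limsup_eq_zero_of_tsum_diff_ne_top {E : ℕ → Set Ω}
    (hE : Tendsto (fun n => μ (E n)) atTop (𝓝 0)) (hsum : ∑' n, μ (E n \ E (n + 1)) ≠ ∞) :
    μ (limsup E atTop) = 0 := by
  have hliminf : μ (liminf E atTop) = 0 := by
    rw [liminf_eq_iSup_iInf_of_nat', Set.iSup_eq_iUnion, measure_iUnion_null_iff]
    refine fun N => le_antisymm (ge_of_tendsto' (hE.comp (tendsto_add_atTop_nat N)) fun n => ?_)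
      zero_le
    exact measure_mono (Set.iInter_subset (fun n => E (n + N)) n)
  refine measure_mono_null_ae ?_ hliminf
  filter_upwards [ae_eventually_notMem hsum] with ω hω hfreq
  obtain ⟨N, hN⟩ := eventually_atTop.1 hω
  obtain ⟨M, hM, hmem⟩ := frequently_atTop.1 (mem_limsup_iff_frequently_mem.1 hfreq) N
  refine mem_liminf_iff_eventually_mem.2 (eventually_atTop.2 ⟨M, fun n hn => ?_⟩)
  induction n, hn using Nat.le_induction with
  | base => exact hmem
  | succ n hn ih => exact not_not.1 fun hnext => hN n (hM.trans hn) ⟨ih, hnext⟩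

end Probability

section ZeroOneLaw

variable {Ω : Type*} {X : ℕ → Ω → ℝ} {ℓ : ℕ → ℝ}

lemma partialMax_le_iff {n : ℕ} {ω : Ω} {x : ℝ} :
    partialMax X n ω ≤ x ↔ ∀ k ∈ Finset.range (n + 1), X k ω ≤ x :=
  Finset.sup'_le_iff _ _

lemma lt_partialMax_iff {n : ℕ} {ω : Ω} {x : ℝ} :
    x < partialMax X n ω ↔ ∃ k ∈ Finset.range (n + 1), x < X k ω :=
  Finset.lt_sup'_iff _

lemma monotone_partialMax (X : ℕ → Ω → ℝ) (ω : Ω) : Monotone fun n => partialMax X n ω :=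
  fun _ _ h => Finset.sup'_mono _ (Finset.range_subset_range.2 (Nat.succ_le_succ h)) _

lemma measurable_partialMax [MeasurableSpace Ω] (hX : ∀ k, Measurable (X k)) (n : ℕ) :
    Measurable (partialMax X n) :=
  Finset.measurable_range_sup'' fun k _ => hX k

/-- The event that the maximum of `X m, …, X n` exceeds `ℓ n` for all large `n`: the analogue of
`eventuallyAbove` that ignores the first `m` variables. -/
def eventuallyAboveFrom (X : ℕ → Ω → ℝ) (ℓ : ℕ → ℝ) (m : ℕ) : Set Ω :=
  {ω | ∀ᶠ n in atTop, ∃ k ∈ Finset.Icc m n, ℓ n < X k ω}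

lemma antitone_eventuallyAboveFrom (X : ℕ → Ω → ℝ) (ℓ : ℕ → ℝ) :
    Antitone (eventuallyAboveFrom X ℓ) := fun _ _ h _ hω =>
  hω.mono fun _ ⟨k, hk, hlt⟩ => ⟨k, Finset.Icc_subset_Icc_left h hk, hlt⟩

lemma measurableSet_eventuallyAboveFrom [MeasurableSpace Ω] {m : ℕ}
    (hX : ∀ k ≥ m, Measurable (X k)) : MeasurableSet (eventuallyAboveFrom X ℓ m) := by
  have hliminf : eventuallyAboveFrom X ℓ m =
      liminf (fun n => ⋃ k ∈ Finset.Icc m n, X k ⁻¹' Set.Ioi (ℓ n)) atTop := by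
    ext ω
    simp only [eventuallyAboveFrom, Set.mem_ofPred_eq, mem_liminf_iff_eventually_mem,
      Set.mem_iUnion, exists_prop, Set.mem_preimage, Set.mem_Ioi]
  rw [hliminf]
  exact MeasurableSet.measurableSet_liminf fun n => Finset.measurableSet_biUnion _ fun k hk =>
    hX k (Finset.mem_Icc.1 hk).1 measurableSet_Ioi

lemma measurableSet_limsup_iInter_eventuallyAboveFrom (X : ℕ → Ω → ℝ) (ℓ : ℕ → ℝ) :
    MeasurableSet[limsup (fun n => MeasurableSpace.comap (X n) inferInstance) atTop]
      (⋂ m, eventuallyAboveFrom X ℓ m) := by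
  rw [limsup_eq_iInf_iSup_of_nat, MeasurableSpace.measurableSet_iInf]
  intro N
  rw [← Set.iInf_eq_iInter, ← (antitone_eventuallyAboveFrom X ℓ).iInf_nat_add N,
    Set.iInf_eq_iInter]
  refine MeasurableSet.iInter fun m =>
    @measurableSet_eventuallyAboveFrom _ _ _ (_) _ fun k hk => ?_
  exact (comap_measurable (X k)).mono
    (le_iSup₂_of_le k ((Nat.le_add_left N m).trans hk) le_rfl) le_rfl

/-- The event that the `n`-th partial maximum does not exceed `ℓ n`. -/
def belowLevel (X : ℕ → Ω → ℝ) (ℓ : ℕ → ℝ) (n : ℕ) : Set Ω := {ω | partialMax X n ω ≤ ℓ n}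

lemma compl_eventuallyAbove (X : ℕ → Ω → ℝ) (ℓ : ℕ → ℝ) :
    (eventuallyAbove X ℓ)ᶜ = limsup (belowLevel X ℓ) atTop := by
  ext ω
  simp only [eventuallyAbove, belowLevel, mem_limsup_iff_frequently_mem, Set.mem_compl_iff,
    Set.mem_ofPred_eq, not_eventually, not_lt]

lemma belowLevel_inter_belowLevel (X : ℕ → Ω → ℝ) (hℓ : Monotone ℓ) {i j : ℕ} (hij : i ≤ j) :
    belowLevel X ℓ i ∩ belowLevel X ℓ j =
      {ω | ∀ k ∈ Finset.range (j + 1), X k ω ≤ if k < i + 1 then ℓ i else ℓ j} := by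
  ext ω
  simp only [belowLevel, Set.mem_inter_iff, Set.mem_ofPred_eq, partialMax_le_iff,
    Finset.mem_range]
  refine ⟨fun ⟨hi, hj⟩ k hk => ?_, fun h => ⟨fun k hk => ?_, fun k hk => (h k hk).trans ?_⟩⟩
  · split_ifs with hki
    · exact hi k hki
    · exact hj k hk
  · simpa only [if_pos hk] using h k (by lia)
  · split_ifs
    · exact hℓ hij
    · exact le_rfl

variable [MeasurableSpace Ω] {μ : Measure Ω}

lemma eventuallyAbove_ae_eq_iInter (hℓ : Monotone ℓ)
    (h : ∀ j, ∀ᵐ ω ∂μ, ∃ n, X j ω ≤ ℓ n) :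
    eventuallyAbove X ℓ =ᵐ[μ] ⋂ m, eventuallyAboveFrom X ℓ m := by
  filter_upwards [ae_all_iff.2 h] with ω hω
  refine propext ⟨fun habove => Set.mem_iInter.2 fun m => ?_, fun htail => ?_⟩
  · have hinitial : ∀ᶠ n in atTop, ∀ k ∈ Finset.range m, X k ω ≤ ℓ n :=
      (eventually_all_finset _).2 fun k _ => by
        obtain ⟨N, hN⟩ := hω k
        filter_upwards [eventually_ge_atTop N] with n hn using hN.trans (hℓ hn)
    filter_upwards [habove, hinitial] with n hlt hle
    obtain ⟨k, hk, hkn⟩ := lt_partialMax_iff.1 hlt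
    refine ⟨k, Finset.mem_Icc.2 ⟨?_, Finset.mem_range_succ_iff.1 hk⟩, hkn⟩
    by_contra! hkm
    exact hkn.not_ge (hle k (Finset.mem_range.2 hkm))
  · refine (Set.mem_iInter.1 htail 0).mono fun n ⟨k, hk, hkn⟩ => ?_
    exact lt_partialMax_iff.2 ⟨k, Finset.mem_range_succ_iff.2 (Finset.mem_Icc.1 hk).2, hkn⟩

lemma measure_eventuallyAbove_eq_zero_or_one_of_ae_exists_le (hX : ∀ k, Measurable (X k))
    (hindep : iIndepFun X μ) (hℓ : Monotone ℓ) (h : ∀ j, ∀ᵐ ω ∂μ, ∃ n, X j ω ≤ ℓ n) :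
    μ (eventuallyAbove X ℓ) = 0 ∨ μ (eventuallyAbove X ℓ) = 1 := by
  rw [measure_congr (eventuallyAbove_ae_eq_iInter hℓ h)]
  exact measure_zero_or_one_of_measurableSet_limsup_atTop (fun k => (hX k).comap_le) hindep
    (measurableSet_limsup_iInter_eventuallyAboveFrom X ℓ)

lemma measurableSet_belowLevel (hX : ∀ k, Measurable (X k)) (n : ℕ) :
    MeasurableSet (belowLevel X ℓ n) :=
  measurable_partialMax hX n measurableSet_Iic

lemma measure_eventuallyAbove_eq_one [IsProbabilityMeasure μ] (hX : ∀ k, Measurable (X k))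
    (h : μ (limsup (belowLevel X ℓ) atTop) = 0) : μ (eventuallyAbove X ℓ) = 1 := by
  have hmeas : MeasurableSet (limsup (belowLevel X ℓ) atTop) :=
    MeasurableSet.measurableSet_limsup (measurableSet_belowLevel hX)
  rw [← compl_compl (eventuallyAbove X ℓ), compl_eventuallyAbove, prob_compl_eq_one_iff hmeas, h]

lemma measure_eventuallyAbove_eq_zero [IsProbabilityMeasure μ] (hX : ∀ k, Measurable (X k))
    (h01 : μ (eventuallyAbove X ℓ) = 0 ∨ μ (eventuallyAbove X ℓ) = 1) {δ : ℝ} (hδ : 0 < δ)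
    (h : ∀ᶠ N in atTop, δ ≤ μ.real (⋃ n, belowLevel X ℓ (n + N))) :
    μ (eventuallyAbove X ℓ) = 0 := by
  refine h01.resolve_right fun hone => ?_
  have hmeas : MeasurableSet (eventuallyAbove X ℓ) := by
    rw [← MeasurableSet.compl_iff, compl_eventuallyAbove]
    exact MeasurableSet.measurableSet_limsup (measurableSet_belowLevel hX)
  have hzero : μ (limsup (belowLevel X ℓ) atTop) = 0 := by
    rw [← compl_eventuallyAbove, prob_compl_eq_zero_iff hmeas, hone]
  refine (ENNReal.ofReal_pos.2 hδ).not_ge (hzero ▸ le_measure_limsup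
    (measurableSet_belowLevel hX) (h.mono fun N hN => ENNReal.ofReal_le_of_le_toReal hN))

end ZeroOneLaw

section Scheme

lemma partialSum_succ_sub (α : ℕ → ℝ) (n : ℕ) :
    partialSum α (n + 1) - partialSum α n = α (n + 1) := by
  rw [partialSum, partialSum, Finset.sum_range_succ _ (n + 1), add_sub_cancel_left]

lemma monotone_partialSum {α : ℕ → ℝ} (hα : ∀ n, 0 ≤ α n) : Monotone (partialSum α) :=
  monotone_nat_of_le_succ fun n =>
    sub_nonneg.1 ((partialSum_succ_sub α n).symm ▸ hα (n + 1))

lemma partialSum_pos {α : ℕ → ℝ} (hα : ∀ n, 0 < α n) (n : ℕ) : 0 < partialSum α n :=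
  Finset.sum_pos (fun k _ => hα k) Finset.nonempty_range_add_one

lemma seriesK_eq_tsum_escapeProb (F : ℝ → ℝ) (α ℓ : ℕ → ℝ) :
    seriesK F α ℓ = ∑' n, ENNReal.ofReal (escapeProb (partialSum α) (tailAt F ℓ) n) := by
  refine tsum_congr fun n => ?_
  rw [← escapeWeight_mul_exp_neg, escapeWeight, partialSum_succ_sub, mul_comm (Real.exp _),
    mul_comm (partialSum α n), mul_comm (α (n + 1))]

lemma seriesK_ne_top_iff {F : ℝ → ℝ} {α ℓ : ℕ → ℝ} (hα : ∀ n, 0 ≤ α n) (hF : ∀ x, F x ≤ 1) :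
    seriesK F α ℓ ≠ ⊤ ↔ Summable (escapeProb (partialSum α) (tailAt F ℓ)) := by
  rw [seriesK_eq_tsum_escapeProb]
  refine ⟨fun h => (ENNReal.summable_toReal h).congr fun n => ?_, Summable.tsum_ofReal_ne_top⟩
  exact ENNReal.toReal_ofReal
    (escapeProb_nonneg (monotone_partialSum hα) (fun n => sub_nonneg.2 (hF (ℓ n))) n)

/-- The hazard rate `-log (F (ℓ n))`: if it is finite, a variable with distribution function
`F ^ a` lies below `ℓ n` with probability `exp (-(levelRate F ℓ n * a))`. Where `F (ℓ n) = 0`, the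
convention `log 0 = 0` makes it `0` instead of `∞`. -/
noncomputable def levelRate (F : ℝ → ℝ) (ℓ : ℕ → ℝ) (n : ℕ) : ℝ := -Real.log (F (ℓ n))

variable {ν : Measure ℝ} {ℓ : ℕ → ℝ}

lemma rpow_eq_exp_levelRate {F : ℝ → ℝ} {n : ℕ} (h : 0 < F (ℓ n)) (a : ℝ) :
    F (ℓ n) ^ a = Real.exp (-(levelRate F ℓ n * a)) := by
  rw [levelRate, neg_mul, neg_neg, Real.rpow_def_of_pos h]

lemma tailAt_nonneg (n : ℕ) : 0 ≤ tailAt (cdf ν) ℓ n := sub_nonneg.2 (cdf_le_one ν _)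

lemma antitone_tailAt (hℓ : Monotone ℓ) : Antitone (tailAt (cdf ν) ℓ) :=
  fun _ _ h => sub_le_sub_left (monotone_cdf ν (hℓ h)) 1

lemma levelRate_nonneg (n : ℕ) : 0 ≤ levelRate (cdf ν) ℓ n :=
  neg_nonneg.2 (Real.log_nonpos (cdf_nonneg ν _) (cdf_le_one ν _))

lemma levelRate_anti {m n : ℕ} (hℓ : Monotone ℓ) (hm : 0 < cdf ν (ℓ m)) (h : m ≤ n) :
    levelRate (cdf ν) ℓ n ≤ levelRate (cdf ν) ℓ m :=
  neg_le_neg (Real.log_le_log hm (monotone_cdf ν (hℓ h)))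

lemma tailAt_le_levelRate {n : ℕ} (h : 0 < cdf ν (ℓ n)) :
    tailAt (cdf ν) ℓ n ≤ levelRate (cdf ν) ℓ n :=
  one_sub_le_neg_log h

lemma levelRate_le_add_sq {n : ℕ} (h : 1 / 2 ≤ cdf ν (ℓ n)) :
    levelRate (cdf ν) ℓ n ≤ tailAt (cdf ν) ℓ n + 2 * tailAt (cdf ν) ℓ n ^ 2 :=
  neg_log_le_add_sq h

lemma levelRate_le_two_mul {n : ℕ} (h : 1 / 2 ≤ cdf ν (ℓ n)) :
    levelRate (cdf ν) ℓ n ≤ 2 * tailAt (cdf ν) ℓ n := by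
  have hhalf : tailAt (cdf ν) ℓ n ≤ 1 / 2 :=
    (sub_le_sub_left h 1).trans_eq (by norm_num)
  nlinarith [levelRate_le_add_sq h, tailAt_nonneg (ν := ν) (ℓ := ℓ) n]

lemma eventually_half_le_cdf (hq : Tendsto (tailAt (cdf ν) ℓ) atTop (𝓝 0)) :
    ∀ᶠ n in atTop, 1 / 2 ≤ cdf ν (ℓ n) := by
  filter_upwards [hq.eventually_le_const (show (0 : ℝ) < 1 / 2 by norm_num)] with n hn
  have htail : 1 - cdf ν (ℓ n) ≤ 1 / 2 := hn
  linarith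

lemma summable_inv_sub_inv_succ {s : ℕ → ℝ} (hs : Monotone s) (hs0 : ∀ n, 0 < s n) :
    Summable fun n => (s n)⁻¹ - (s (n + 1))⁻¹ := by
  refine summable_of_sum_range_le (c := (s 0)⁻¹)
    (fun n => sub_nonneg.2 (inv_anti₀ (hs0 n) (hs n.le_succ))) fun n => ?_
  rw [Finset.sum_range_sub' fun n => (s n)⁻¹]
  exact sub_le_self _ (inv_nonneg.2 (hs0 n).le)

lemma summable_escapeProb_levelRate {s : ℕ → ℝ} (hs : Monotone s) (hs0 : ∀ n, 0 < s n)
    (hq : Tendsto (tailAt (cdf ν) ℓ) atTop (𝓝 0))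
    (hsum : Summable (escapeProb s (tailAt (cdf ν) ℓ))) :
    Summable (escapeProb s (levelRate (cdf ν) ℓ)) := by
  refine (hsum.mul_left 2).of_norm_bounded_eventually_nat ?_
  filter_upwards [eventually_half_le_cdf hq] with n hn
  rw [Real.norm_of_nonneg (escapeProb_nonneg hs levelRate_nonneg n)]
  exact exp_neg_sub_exp_neg_le_two_mul (hs0 n).le (hs n.le_succ)
    (tailAt_le_levelRate (one_half_pos.trans_le hn)) (levelRate_le_two_mul hn)

lemma summable_escapeProb_tailAt {s : ℕ → ℝ} (hs : Monotone s) (hs0 : ∀ n, 0 < s n)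
    (hq : Tendsto (tailAt (cdf ν) ℓ) atTop (𝓝 0))
    (hsum : Summable (escapeProb s (levelRate (cdf ν) ℓ))) :
    Summable (escapeProb s (tailAt (cdf ν) ℓ)) := by
  refine ((hsum.mul_left (Real.exp 2)).add
    ((summable_inv_sub_inv_succ hs hs0).mul_left 24)).of_norm_bounded_eventually_nat ?_
  filter_upwards [eventually_half_le_cdf hq] with n hn
  rw [Real.norm_of_nonneg (escapeProb_nonneg hs tailAt_nonneg n)]
  exact exp_neg_sub_exp_neg_le_add_inv (hs0 n) (hs n.le_succ) (tailAt_nonneg n)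
    (sub_le_self 1 (cdf_nonneg ν _)) (tailAt_le_levelRate (one_half_pos.trans_le hn))
    (levelRate_le_add_sq hn)

variable {Ω : Type*} [MeasurableSpace Ω] {μ : Measure Ω} {α : ℕ → ℝ} {X : ℕ → Ω → ℝ}

lemma IsFAlphaScheme.measureReal_forall_le (hX : IsFAlphaScheme μ (cdf ν) α X) (c : ℕ → ℝ)
    (n : ℕ) : μ.real {ω | ∀ k ∈ Finset.range n, X k ω ≤ c k} =
      ∏ k ∈ Finset.range n, cdf ν (c k) ^ α k := by
  have hinter : {ω | ∀ k ∈ Finset.range n, X k ω ≤ c k} =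
      ⋂ k ∈ Finset.range n, X k ⁻¹' Set.Iic (c k) := by
    ext ω
    simp only [Set.mem_ofPred_eq, Set.mem_iInter, Set.mem_preimage, Set.mem_Iic]
  rw [measureReal_def, hinter, hX.indep.measure_inter_preimage_eq_mul _
    (fun k _ => measurableSet_Iic), ENNReal.toReal_prod]
  refine Finset.prod_congr rfl fun k _ => ?_
  rw [show μ (X k ⁻¹' Set.Iic (c k)) = _ from hX.cdf_eq k (c k),
    ENNReal.toReal_ofReal (Real.rpow_nonneg (cdf_nonneg _ _) _)]

lemma IsFAlphaScheme.measureReal_partialMax_le (hX : IsFAlphaScheme μ (cdf ν) α X)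
    (hα : ∀ n, 0 ≤ α n) (n : ℕ) (x : ℝ) :
    μ.real {ω | partialMax X n ω ≤ x} = cdf ν x ^ partialSum α n := by
  simp only [partialMax_le_iff]
  rw [hX.measureReal_forall_le (fun _ => x), partialSum,
    Real.rpow_sum_of_nonneg (cdf_nonneg _ _) fun k _ => hα k]

lemma IsFAlphaScheme.measureReal_belowLevel (hX : IsFAlphaScheme μ (cdf ν) α X)
    (hα : ∀ n, 0 ≤ α n) {n : ℕ} (hn : 0 < cdf ν (ℓ n)) :
    μ.real (belowLevel X ℓ n) = Real.exp (-(levelRate (cdf ν) ℓ n * partialSum α n)) := by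
  rw [belowLevel, hX.measureReal_partialMax_le hα, rpow_eq_exp_levelRate hn]

lemma IsFAlphaScheme.measureReal_belowLevel_inter (hX : IsFAlphaScheme μ (cdf ν) α X)
    (hα : ∀ n, 0 ≤ α n) (hℓ : Monotone ℓ) {i j : ℕ} (hij : i ≤ j) (hi : 0 < cdf ν (ℓ i)) :
    μ.real (belowLevel X ℓ i ∩ belowLevel X ℓ j) =
      Real.exp (partialSum α i * levelRate (cdf ν) ℓ j -
        levelRate (cdf ν) ℓ i * partialSum α i - levelRate (cdf ν) ℓ j * partialSum α j) := by
  have hj : 0 < cdf ν (ℓ j) := hi.trans_le (monotone_cdf ν (hℓ hij))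
  have hlow : ∏ k ∈ Finset.range (i + 1), cdf ν (if k < i + 1 then ℓ i else ℓ j) ^ α k =
      cdf ν (ℓ i) ^ partialSum α i := by
    rw [partialSum, Real.rpow_sum_of_nonneg hi.le fun k _ => hα k]
    exact Finset.prod_congr rfl fun k hk => by rw [if_pos (Finset.mem_range.1 hk)]
  have hhigh : ∏ k ∈ Finset.Ico (i + 1) (j + 1), cdf ν (if k < i + 1 then ℓ i else ℓ j) ^ α k =
      cdf ν (ℓ j) ^ (partialSum α j - partialSum α i) := by
    rw [partialSum, partialSum, ← Finset.sum_Ico_eq_sub _ (by lia),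
      Real.rpow_sum_of_nonneg hj.le fun k _ => hα k]
    exact Finset.prod_congr rfl fun k hk => by rw [if_neg (Finset.mem_Ico.1 hk).1.not_gt]
  rw [belowLevel_inter_belowLevel X hℓ hij,
    hX.measureReal_forall_le (fun k => if k < i + 1 then ℓ i else ℓ j),
    ← Finset.prod_range_mul_prod_Ico _ (Nat.succ_le_succ hij), hlow, hhigh,
    rpow_eq_exp_levelRate hi, rpow_eq_exp_levelRate hj, ← Real.exp_add]
  ring_nf

end Scheme

section Criterion

variable {Ω : Type*} [MeasurableSpace Ω] {μ : Measure Ω} [IsProbabilityMeasure μ]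
  {ν : Measure ℝ} {α ℓ : ℕ → ℝ} {X : ℕ → Ω → ℝ}

lemma IsFAlphaScheme.ae_exists_le (hX : IsFAlphaScheme μ (cdf ν) α X)
    (hq : Tendsto (tailAt (cdf ν) ℓ) atTop (𝓝 0)) (j : ℕ) : ∀ᵐ ω ∂μ, ∃ n, X j ω ≤ ℓ n := by
  have hcdf : Tendsto (fun n => cdf ν (ℓ n)) atTop (𝓝 1) := by
    simpa only [tailAt, sub_sub_cancel, sub_zero] using hq.const_sub 1
  have hprob : Tendsto (fun n => μ {ω | X j ω ≤ ℓ n}) atTop (𝓝 1) := by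
    simp only [hX.cdf_eq]
    simpa only [Real.one_rpow, ENNReal.ofReal_one] using
      ENNReal.tendsto_ofReal (hcdf.rpow_const (p := α j) (Or.inl one_ne_zero))
  have hmeas : MeasurableSet {ω | ∃ n, X j ω ≤ ℓ n} := by
    rw [Set.ofPred_exists]
    exact MeasurableSet.iUnion fun n => hX.measurable j measurableSet_Iic
  refine (mem_ae_iff_prob_eq_one hmeas).2 (le_antisymm prob_le_one ?_)
  exact le_of_tendsto' hprob fun n => measure_mono fun ω hω => ⟨n, hω⟩

lemma IsFAlphaScheme.measure_eventuallyAbove_eq_zero_or_one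
    (hX : IsFAlphaScheme μ (cdf ν) α X) (hℓ : Monotone ℓ)
    (hq : Tendsto (tailAt (cdf ν) ℓ) atTop (𝓝 0)) :
    μ (eventuallyAbove X ℓ) = 0 ∨ μ (eventuallyAbove X ℓ) = 1 :=
  measure_eventuallyAbove_eq_zero_or_one_of_ae_exists_le hX.measurable hX.indep hℓ
    (hX.ae_exists_le hq)

lemma IsFAlphaScheme.measure_exists_partialMax_le_le (hX : IsFAlphaScheme μ (cdf ν) α X)
    (hα : ∀ n, 0 ≤ α n) (hℓ : Monotone ℓ) {b : ℝ} (hb : ∀ n, cdf ν (ℓ n) ≤ b) (N : ℕ) :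
    μ {ω | ∃ n, partialMax X N ω ≤ ℓ n} ≤ ENNReal.ofReal (b ^ partialSum α N) := by
  have hmono : Monotone fun n => {ω | partialMax X N ω ≤ ℓ n} := fun m n h ω hω =>
    le_trans hω (hℓ h)
  rw [Set.ofPred_exists, hmono.measure_iUnion]
  refine iSup_le fun n => ?_
  rw [← ofReal_measureReal, hX.measureReal_partialMax_le hα]
  exact ENNReal.ofReal_le_ofReal (Real.rpow_le_rpow (cdf_nonneg ν _) (hb n)
    (Finset.sum_nonneg fun k _ => hα k))

lemma IsFAlphaScheme.measure_eventuallyAbove_eq_one_of_tendsto_pos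
    (hX : IsFAlphaScheme μ (cdf ν) α X) (hα : ∀ n, 0 ≤ α n)
    (hs : Tendsto (partialSum α) atTop atTop) (hℓ : Monotone ℓ) {c : ℝ} (hc : 0 < c)
    (hq : Tendsto (tailAt (cdf ν) ℓ) atTop (𝓝 c)) : μ (eventuallyAbove X ℓ) = 1 := by
  have hcdf : ∀ n, cdf ν (ℓ n) ≤ 1 - c := fun n =>
    le_sub_comm.1 ((antitone_tailAt hℓ).le_of_tendsto hq n)
  have hpow : Tendsto (fun N => ENNReal.ofReal ((1 - c) ^ partialSum α N)) atTop (𝓝 0) := by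
    rw [← ENNReal.ofReal_zero]
    have hbase : -1 < 1 - c := by linarith [cdf_nonneg ν (ℓ 0), hcdf 0]
    exact ENNReal.tendsto_ofReal
      ((tendsto_rpow_atTop_of_base_lt_one _ hbase (by linarith)).comp hs)
  refine measure_eventuallyAbove_eq_one hX.measurable
    (le_antisymm (ge_of_tendsto' hpow fun N => ?_) zero_le)
  refine (measure_mono fun ω hω => ?_).trans (hX.measure_exists_partialMax_le_le hα hℓ hcdf N)
  obtain ⟨n, hNn, hn⟩ := frequently_atTop.1 (mem_limsup_iff_frequently_mem.1 hω) N
  exact ⟨n, (monotone_partialMax X ω hNn).trans hn⟩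

lemma IsFAlphaScheme.measure_eventuallyAbove_eq_zero_of_frequently_le
    (hX : IsFAlphaScheme μ (cdf ν) α X) (hα : ∀ n, 0 ≤ α n) (hℓ : Monotone ℓ)
    (hq : Tendsto (tailAt (cdf ν) ℓ) atTop (𝓝 0)) {C : ℝ}
    (hC : ∃ᶠ n in atTop, partialSum α n * tailAt (cdf ν) ℓ n ≤ C) :
    μ (eventuallyAbove X ℓ) = 0 := by
  refine measure_eventuallyAbove_eq_zero hX.measurable
    (hX.measure_eventuallyAbove_eq_zero_or_one hℓ hq) (Real.exp_pos (-(2 * C)))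
    (Eventually.of_forall fun N => ?_)
  obtain ⟨n, hNn, hCn, hn⟩ :=
    frequently_atTop.1 (hC.and_eventually (eventually_half_le_cdf hq)) N
  have hs0 : 0 ≤ partialSum α n := Finset.sum_nonneg fun k _ => hα k
  have hrate : levelRate (cdf ν) ℓ n * partialSum α n ≤ 2 * C := by
    nlinarith [mul_le_mul_of_nonneg_right (levelRate_le_two_mul hn) hs0]
  calc Real.exp (-(2 * C)) ≤ Real.exp (-(levelRate (cdf ν) ℓ n * partialSum α n)) := by gcongr
    _ = μ.real (belowLevel X ℓ n) :=
      (hX.measureReal_belowLevel hα (one_half_pos.trans_le hn)).symm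
    _ ≤ μ.real (⋃ n, belowLevel X ℓ (n + N)) := measureReal_mono
      (Set.subset_iUnion_of_subset (n - N) (by rw [Nat.sub_add_cancel hNn]))

lemma IsFAlphaScheme.measure_eventuallyAbove_eq_zero_of_seriesK_eq_top
    (hX : IsFAlphaScheme μ (cdf ν) α X) (hα : ∀ n, 0 < α n) (hℓ : Monotone ℓ)
    (hq : Tendsto (tailAt (cdf ν) ℓ) atTop (𝓝 0)) (hK : seriesK (cdf ν) α ℓ = ⊤) :
    μ (eventuallyAbove X ℓ) = 0 := by
  have hα0 : ∀ n, 0 ≤ α n := fun n => (hα n).le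
  have hs := monotone_partialSum hα0
  refine measure_eventuallyAbove_eq_zero hX.measurable
    (hX.measure_eventuallyAbove_eq_zero_or_one hℓ hq) (δ := 1 / 44) (by norm_num) ?_
  filter_upwards [eventually_half_le_cdf hq] with N hN
  have hpos : ∀ n, 0 < cdf ν (ℓ (n + N)) := fun n =>
    (one_half_pos.trans_le hN).trans_le (monotone_cdf ν (hℓ (Nat.le_add_left N n)))
  refine le_measureReal_iUnion_of_not_summable_escapeProb (s := fun n => partialSum α (n + N))
    (r := fun n => levelRate (cdf ν) ℓ (n + N)) (fun m n h => hs (Nat.add_le_add_right h N))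
    (fun n => partialSum_pos hα _)
    (fun m n h => levelRate_anti hℓ (hpos m) (Nat.add_le_add_right h N))
    (fun n => levelRate_nonneg _) (fun n => measurableSet_belowLevel hX.measurable _)
    (fun i j hij => hX.measureReal_belowLevel_inter hα0 hℓ (Nat.add_le_add_right hij N) (hpos i))
    fun hsum => ?_
  have hshift : Summable fun n =>
      escapeProb (partialSum α) (levelRate (cdf ν) ℓ) (n + N) :=
    hsum.congr fun n => by rw [escapeProb, escapeProb, add_right_comm]
  exact (seriesK_ne_top_iff hα0 (cdf_le_one ν)).2 (summable_escapeProb_tailAt hs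
    (partialSum_pos hα) hq ((summable_nat_add_iff N).1 hshift)) hK

lemma IsFAlphaScheme.tendsto_measure_belowLevel (hX : IsFAlphaScheme μ (cdf ν) α X)
    (hα : ∀ n, 0 ≤ α n) (hq : Tendsto (tailAt (cdf ν) ℓ) atTop (𝓝 0))
    (hsq : Tendsto (fun n => partialSum α n * tailAt (cdf ν) ℓ n) atTop atTop) :
    Tendsto (fun n => μ (belowLevel X ℓ n)) atTop (𝓝 0) := by
  rw [← ENNReal.tendsto_toReal_zero_iff (fun n => measure_ne_top μ _)]
  refine squeeze_zero' (Eventually.of_forall fun n => measureReal_nonneg) ?_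
    (Real.tendsto_exp_neg_atTop_nhds_zero.comp hsq)
  filter_upwards [eventually_half_le_cdf hq] with n hn
  have hpos := one_half_pos.trans_le hn
  have hs0 : 0 ≤ partialSum α n := Finset.sum_nonneg fun k _ => hα k
  rw [← measureReal_def, hX.measureReal_belowLevel hα hpos, mul_comm]
  exact Real.exp_le_exp.2 (neg_le_neg (mul_le_mul_of_nonneg_left (tailAt_le_levelRate hpos) hs0))

lemma IsFAlphaScheme.measureReal_belowLevel_diff_succ_le (hX : IsFAlphaScheme μ (cdf ν) α X)
    (hα : ∀ n, 0 ≤ α n) (hℓ : Monotone ℓ) {n : ℕ} (hn : 0 < cdf ν (ℓ n)) :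
    μ.real (belowLevel X ℓ n \ belowLevel X ℓ (n + 1)) ≤
      escapeProb (partialSum α) (levelRate (cdf ν) ℓ) n := by
  have hmono := fun ω => monotone_partialMax X ω n.le_succ
  calc μ.real (belowLevel X ℓ n \ belowLevel X ℓ (n + 1))
      ≤ μ.real ({ω | partialMax X n ω ≤ ℓ n} \ {ω | partialMax X (n + 1) ω ≤ ℓ n}) :=
        measureReal_mono (Set.sdiff_subset_sdiff_right fun ω hω => le_trans hω (hℓ n.le_succ))
    _ = μ.real {ω | partialMax X n ω ≤ ℓ n} - μ.real {ω | partialMax X (n + 1) ω ≤ ℓ n} :=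
        measureReal_sdiff (fun ω hω => (hmono ω).trans hω)
          (measurable_partialMax hX.measurable _ measurableSet_Iic)
    _ = escapeProb (partialSum α) (levelRate (cdf ν) ℓ) n := by
        rw [hX.measureReal_partialMax_le hα, hX.measureReal_partialMax_le hα,
          rpow_eq_exp_levelRate hn, rpow_eq_exp_levelRate hn, escapeProb]

lemma IsFAlphaScheme.measure_eventuallyAbove_eq_one_of_seriesK_lt_top
    (hX : IsFAlphaScheme μ (cdf ν) α X) (hα : ∀ n, 0 < α n) (hℓ : Monotone ℓ)
    (hq : Tendsto (tailAt (cdf ν) ℓ) atTop (𝓝 0))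
    (hsq : Tendsto (fun n => partialSum α n * tailAt (cdf ν) ℓ n) atTop atTop)
    (hK : seriesK (cdf ν) α ℓ < ⊤) : μ (eventuallyAbove X ℓ) = 1 := by
  have hα0 : ∀ n, 0 ≤ α n := fun n => (hα n).le
  have hescape : Summable (escapeProb (partialSum α) (levelRate (cdf ν) ℓ)) :=
    summable_escapeProb_levelRate (monotone_partialSum hα0) (partialSum_pos hα) hq
      ((seriesK_ne_top_iff hα0 (cdf_le_one ν)).1 hK.ne)
  have hdiff : Summable fun n => μ.real (belowLevel X ℓ n \ belowLevel X ℓ (n + 1)) := by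
    refine hescape.of_norm_bounded_eventually_nat ?_
    filter_upwards [eventually_half_le_cdf hq] with n hn
    rw [Real.norm_of_nonneg measureReal_nonneg]
    exact hX.measureReal_belowLevel_diff_succ_le hα0 hℓ (one_half_pos.trans_le hn)
  refine measure_eventuallyAbove_eq_one hX.measurable
    (measure_limsup_eq_zero_of_tsum_diff_ne_top (hX.tendsto_measure_belowLevel hα0 hq hsq) ?_)
  rw [← tsum_congr fun n => ofReal_measureReal (measure_ne_top μ _)]
  exact hdiff.tsum_ofReal_ne_top

lemma exists_tendsto_tailAt (hℓ : Monotone ℓ) :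
    ∃ c, 0 ≤ c ∧ Tendsto (tailAt (cdf ν) ℓ) atTop (𝓝 c) :=
  ⟨⨅ n, tailAt (cdf ν) ℓ n, Real.iInf_nonneg tailAt_nonneg,
    tendsto_atTop_ciInf (antitone_tailAt hℓ) ⟨0, Set.forall_mem_range.2 tailAt_nonneg⟩⟩

lemma exists_frequently_le_of_liminf_lt_top {u : ℕ → ℝ}
    (h : liminf (fun n => (u n : EReal)) atTop < ⊤) : ∃ C : ℝ, ∃ᶠ n in atTop, u n ≤ C := by
  obtain ⟨C, hC, -⟩ := EReal.lt_iff_exists_real_btwn.1 h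
  exact ⟨C, (frequently_lt_of_liminf_lt (by isBoundedDefault) hC).mono fun n hn =>
    (EReal.coe_lt_coe_iff.1 hn).le⟩

end Criterion

theorem corollary2_general {Ω : Type*} [MeasurableSpace Ω] (μ : Measure Ω)
    [IsProbabilityMeasure μ] (ν : Measure ℝ) [IsProbabilityMeasure ν]
    (α : ℕ → ℝ) (hα : ∀ n, 0 < α n) (hs : Tendsto (partialSum α) atTop atTop)
    (X : ℕ → Ω → ℝ) (hX : IsFAlphaScheme μ (cdf ν) α X)
    (ℓ : ℕ → ℝ) (hℓ : Monotone ℓ) :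
    (μ (eventuallyAbove X ℓ) = 0 ∨ μ (eventuallyAbove X ℓ) = 1) ∧
    (∀ c : ℝ, 0 < c → Tendsto (tailAt (cdf ν) ℓ) atTop (𝓝 c) →
      μ (eventuallyAbove X ℓ) = 1) ∧
    (Tendsto (tailAt (cdf ν) ℓ) atTop (𝓝 0) →
      liminf (fun n => ((partialSum α n * tailAt (cdf ν) ℓ n : ℝ) : EReal)) atTop < ⊤ →
      μ (eventuallyAbove X ℓ) = 0) ∧
    (Tendsto (tailAt (cdf ν) ℓ) atTop (𝓝 0) →
      Tendsto (fun n => partialSum α n * tailAt (cdf ν) ℓ n) atTop atTop →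
      (seriesK (cdf ν) α ℓ = ⊤ → μ (eventuallyAbove X ℓ) = 0) ∧
      (seriesK (cdf ν) α ℓ < ⊤ → μ (eventuallyAbove X ℓ) = 1)) := by
  have hα0 : ∀ n, 0 ≤ α n := fun n => (hα n).le
  have hpos : ∀ c : ℝ, 0 < c → Tendsto (tailAt (cdf ν) ℓ) atTop (𝓝 c) →
      μ (eventuallyAbove X ℓ) = 1 := fun c hc hq =>
    hX.measure_eventuallyAbove_eq_one_of_tendsto_pos hα0 hs hℓ hc hq
  refine ⟨?_, hpos, fun hq hliminf => ?_, fun hq hsq => ⟨fun hK => ?_, fun hK => ?_⟩⟩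
  · obtain ⟨c, hc, hq⟩ := exists_tendsto_tailAt (ν := ν) hℓ
    rcases hc.eq_or_lt with rfl | hc
    · exact hX.measure_eventuallyAbove_eq_zero_or_one hℓ hq
    · exact Or.inr (hpos c hc hq)
  · obtain ⟨C, hC⟩ := exists_frequently_le_of_liminf_lt_top hliminf
    exact hX.measure_eventuallyAbove_eq_zero_of_frequently_le hα0 hℓ hq hC
  · exact hX.measure_eventuallyAbove_eq_zero_of_seriesK_eq_top hα hℓ hq hK
  · exact hX.measure_eventuallyAbove_eq_one_of_seriesK_lt_top hα hℓ hq hsq hK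

theorem corollary2 {Ω : Type*} [MeasurableSpace Ω] (μ : Measure Ω) [IsProbabilityMeasure μ]
    (ν : Measure ℝ) [IsProbabilityMeasure ν] (hF : Continuous (cdf ν))
    (α : ℕ → ℝ) (hα : ∀ n, 0 < α n) (hs : Tendsto (partialSum α) atTop atTop)
    (X : ℕ → Ω → ℝ) (hX : IsFAlphaScheme μ (cdf ν) α X)
    (ℓ : ℕ → ℝ) (hℓ : Monotone ℓ) :
    (μ (eventuallyAbove X ℓ) = 0 ∨ μ (eventuallyAbove X ℓ) = 1) ∧
    (∀ c : ℝ, 0 < c → Tendsto (tailAt (cdf ν) ℓ) atTop (𝓝 c) →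
      μ (eventuallyAbove X ℓ) = 1) ∧
    (Tendsto (tailAt (cdf ν) ℓ) atTop (𝓝 0) →
      liminf (fun n => ((partialSum α n * tailAt (cdf ν) ℓ n : ℝ) : EReal)) atTop < ⊤ →
      μ (eventuallyAbove X ℓ) = 0) ∧
    (Tendsto (tailAt (cdf ν) ℓ) atTop (𝓝 0) →
      Tendsto (fun n => partialSum α n * tailAt (cdf ν) ℓ n) atTop atTop →
      (seriesK (cdf ν) α ℓ = ⊤ → μ (eventuallyAbove X ℓ) = 0) ∧
      (seriesK (cdf ν) α ℓ < ⊤ → μ (eventuallyAbove X ℓ) = 1)) :=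
  corollary2_general μ ν α hα hs X hX ℓ hℓ
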